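/- Theorem 3.10. Let $S$ be a commutative semiring with $1 \neq 0$ and let $M$ be a nontrivial cancellative torsion-free commutative monoid, written additively (torsion-free: $n u = n v$ with $n \geq 1$ implies $u = v$). Then the monoid semiring $S[M]$ is a content $S$-semialgebra if and only if $S$ is a subtractive semiring; and the Dedekind–Mertens content formula holds for $S[M]$ if and only if $S$ is a subtractive semiring. Here $S$ is subtractive if every ideal $I$ of $S$ is subtractive, i.e. $a+b\in I$ and $a\in I$ imply $b\in I$. For a commutative $S$-semialgebra $B$ and $f\in B$, the content $c(f)$ is the intersection of all ideals $I$ of $S$ such that $f\in IB$. The Dedekind–Mertens content formula holds for $B$ if for all $f,g\in B$ there is an integer $m\geq 0$ with $c(f)^{m+1}c(g)=c(f)^m c(fg)$. The semialgebra $B$ is a content $S$-semialgebra if $f\in c(f)B$ for all $f\in B$, $c(sf)=s\,c(f)$ for all $s\in S$ and $f\in B$, $c(B)=S$ where $c(B)=\sum_{f\in B}c(f)$, and the Dedekind–Mertens content formula holds for $B$. -/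

import Mathlib

namespace SemiringContent

/-- An ideal `I` of a commutative semiring is subtractive if `a + b ∈ I` and `a ∈ I` imply
`b ∈ I`. -/
def IsSubtractive {S : Type*} [CommSemiring S] (I : Ideal S) : Prop :=
  ∀ a b : S, a + b ∈ I → a ∈ I → b ∈ I

/-- A commutative semiring is subtractive if all of its ideals are subtractive. -/
def IsSubtractiveSemiring (S : Type*) [CommSemiring S] : Prop :=
  ∀ I : Ideal S, IsSubtractive I

/-- The content `c(f)` of an element `f` of an `S`-semialgebra `B`: the intersection of all ideals
`I` of `S` with `f ∈ IB`. Here `IB`, the ideal of `B` generated by the image of `I`, is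
`I.map (algebraMap S B)`. -/
def content (S : Type*) [CommSemiring S] {B : Type*} [CommSemiring B] [Algebra S B] (f : B) :
    Ideal S :=
  sInf {I : Ideal S | f ∈ I.map (algebraMap S B)}

/-- `B` is an Ohm-Rush `S`-semialgebra (that is, a content `S`-semimodule) if `f ∈ c(f)B` for
each `f ∈ B`. -/
def IsOhmRush (S : Type*) [CommSemiring S] (B : Type*) [CommSemiring B] [Algebra S B] : Prop :=
  ∀ f : B, f ∈ (content S f).map (algebraMap S B)

/-- The Dedekind-Mertens content formula: for all `f, g ∈ B` there is an `m ≥ 0` with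
`c(f)^(m+1) c(g) = c(f)^m c(fg)`. -/
def DedekindMertens (S : Type*) [CommSemiring S] (B : Type*) [CommSemiring B] [Algebra S B] :
    Prop :=
  ∀ f g : B, ∃ m : ℕ,
    content S f ^ (m + 1) * content S g = content S f ^ m * content S (f * g)

/-- `B` is a content `S`-semialgebra: it is Ohm-Rush, its content function is homogeneous with
`c(B) = S`, where `c(B)` is the sum of all `c(f)`, and the Dedekind-Mertens content formula
holds. -/
structure IsContentSemialgebra (S : Type*) [CommSemiring S] (B : Type*) [CommSemiring B]
    [Algebra S B] : Prop where
  ohmRush : IsOhmRush S B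
  homogeneous : ∀ (s : S) (f : B), content S (s • f) = Ideal.span {s} * content S f
  content_top : ⨆ f : B, content S f = ⊤
  dedekindMertens : DedekindMertens S B

end SemiringContent

/-! In `S[M]` the content is the ideal generated by the coefficients, so everything except the
Dedekind–Mertens formula holds over any `S`. That formula, tested on `1 + X` and `a + b X + a X ^
2`, forces subtractivity. Conversely, unique sums provide terms of `f` and `g` whose coefficients
multiply to a coefficient of `f * g`. Erasing either term gives an induction
(`content_pow_mul_content_le`), where subtractivity stands in for subtraction and
`pow_mul_le_of_split` does the ideal arithmetic. -/

/-- A cancellative torsion-free commutative monoid has unique sums. -/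
theorem AddCancelCommMonoid.uniqueSums_of_isAddTorsionFree (M : Type*) [AddCancelCommMonoid M]
    [IsAddTorsionFree M] : UniqueSums M where
  uniqueAdd_of_nonempty {A B} hA hB := by
    classical
    -- Unique sums concern two finite sets, so `M` may be replaced by the finitely generated
    -- submonoid they span, which is affine.
    let N : AddSubmonoid M := AddSubmonoid.closure (A ∪ B : Finset M)
    have hfg : AddMonoid.FG N := (AddMonoid.fg_iff_addSubmonoid_fg N).2 ⟨_, rfl⟩
    have htf : IsAddTorsionFree N := ⟨fun n hn x y hxy ↦
      Subtype.ext (IsAddTorsionFree.nsmul_right_injective hn (congrArg Subtype.val hxy))⟩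
    have hAN : ∀ x ∈ A, x ∈ N := fun x hx ↦ AddSubmonoid.subset_closure (by simp [hx])
    have hBN : ∀ x ∈ B, x ∈ N := fun x hx ↦ AddSubmonoid.subset_closure (by simp [hx])
    let _ : AddCancelCommMonoid N :=
      { (inferInstance : AddCommMonoid N) with
        add_left_cancel := fun _ _ _ h ↦ Subtype.ext (add_left_cancel (congrArg Subtype.val h)) }
    have : TwoUniqueSums N := AffineAddMonoid.to_twoUniqueSums
    obtain ⟨a, ha, b, hb, h⟩ := UniqueSums.uniqueAdd_of_nonempty
      (A := A.subtype (· ∈ N)) (B := B.subtype (· ∈ N))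
      (hA.elim fun x hx ↦ ⟨⟨x, hAN x hx⟩, by simpa using hx⟩)
      (hB.elim fun x hx ↦ ⟨⟨x, hBN x hx⟩, by simpa using hx⟩)
    refine ⟨a, by simpa using ha, b, by simpa using hb, fun x y hx hy hxy ↦ ?_⟩
    simpa [Subtype.ext_iff] using h (a := ⟨x, hAN x hx⟩) (b := ⟨y, hBN y hy⟩) (by simpa using hx)
      (by simpa using hy) (Subtype.ext hxy)

namespace SemiringContent

section Coefficients

variable {S M : Type*} [CommSemiring S] [AddCommMonoid M]

theorem mem_map_algebraMap_iff (I : Ideal S) (f : AddMonoidAlgebra S M) :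
    f ∈ I.map (algebraMap S (AddMonoidAlgebra S M)) ↔ ∀ m, f.coeff m ∈ I := by
  classical
  constructor
  · intro hf
    let J : Ideal (AddMonoidAlgebra S M) :=
      { carrier := {f | ∀ m, f.coeff m ∈ I}
        add_mem' := fun hf hg m ↦ I.add_mem (hf m) (hg m)
        zero_mem' := fun m ↦ I.zero_mem
        smul_mem' := fun g f hf m ↦ by
          rw [smul_eq_mul, AddMonoidAlgebra.coeff_mul]
          refine I.sum_mem fun i _ ↦ I.sum_mem fun j _ ↦ ?_
          dsimp only
          split_ifs
          · exact I.mul_mem_left _ (hf j)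
          · exact I.zero_mem }
    have hJ : I.map (algebraMap S (AddMonoidAlgebra S M)) ≤ J := by
      refine Ideal.map_le_iff_le_comap.2 fun s hs m ↦ ?_
      rw [AddMonoidAlgebra.coe_algebraMap, Function.comp_apply,
        AddMonoidAlgebra.coeff_single, Finsupp.single_apply]
      split_ifs
      · exact hs
      · exact I.zero_mem
    exact hJ hf
  · intro hf
    rw [← AddMonoidAlgebra.sum_coeff_single f]
    refine Ideal.sum_mem _ fun m _ ↦ ?_
    have hm : AddMonoidAlgebra.single m (f.coeff m) =
        algebraMap S (AddMonoidAlgebra S M) (f.coeff m) * AddMonoidAlgebra.single m 1 := by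
      simp [AddMonoidAlgebra.single_mul_single]
    exact hm ▸ Ideal.mul_mem_right _ _ (Ideal.mem_map_of_mem _ (hf m))

theorem content_le_iff {f : AddMonoidAlgebra S M} {I : Ideal S} :
    content S f ≤ I ↔ ∀ m, f.coeff m ∈ I := by
  refine ⟨fun h m ↦ h ?_, fun h ↦ sInf_le ((mem_map_algebraMap_iff I f).2 h)⟩
  exact Submodule.mem_sInf.2 fun J hJ ↦ (mem_map_algebraMap_iff J f).1 hJ m

theorem coeff_mem_content (f : AddMonoidAlgebra S M) (m : M) : f.coeff m ∈ content S f :=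
  content_le_iff.1 le_rfl m

theorem content_eq_span (f : AddMonoidAlgebra S M) :
    content S f = Ideal.span (Set.range f.coeff) :=
  le_antisymm (content_le_iff.2 fun m ↦ Ideal.subset_span ⟨m, rfl⟩)
    (Ideal.span_le.2 (Set.range_subset_iff.2 (coeff_mem_content f)))

theorem content_zero : content S (0 : AddMonoidAlgebra S M) = ⊥ :=
  le_bot_iff.1 (content_le_iff.2 fun _ ↦ Ideal.zero_mem _)

theorem content_eq_top_of_coeff_eq_one {f : AddMonoidAlgebra S M} {m : M} (h : f.coeff m = 1) :
    content S f = ⊤ :=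
  (Ideal.eq_top_iff_one _).2 (h ▸ coeff_mem_content f m)

theorem content_single_le (m : M) (s : S) :
    content S (AddMonoidAlgebra.single m s) ≤ Ideal.span {s} := by
  classical
  refine content_le_iff.2 fun k ↦ ?_
  rw [AddMonoidAlgebra.coeff_single, Finsupp.single_apply]
  split_ifs
  · exact Ideal.mem_span_singleton_self s
  · exact Ideal.zero_mem _

theorem content_smul (s : S) (f : AddMonoidAlgebra S M) :
    content S (s • f) = Ideal.span {s} * content S f := by
  rw [content_eq_span, content_eq_span, Ideal.span_mul_span']
  congr 1
  ext x
  simp [Set.singleton_mul]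

theorem content_mul_le (f g : AddMonoidAlgebra S M) :
    content S (f * g) ≤ content S f * content S g := by
  classical
  refine content_le_iff.2 fun m ↦ ?_
  rw [AddMonoidAlgebra.coeff_mul]
  refine Ideal.sum_mem _ fun i _ ↦ Ideal.sum_mem _ fun j _ ↦ ?_
  dsimp only
  split_ifs
  · exact Ideal.mul_mem_mul (coeff_mem_content f i) (coeff_mem_content g j)
  · exact Ideal.zero_mem _

theorem content_eq_span_coeff_add_content_erase (f : AddMonoidAlgebra S M) (m : M) :
    content S f = Ideal.span {f.coeff m} + content S (f.erase m) := by
  classical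
  refine le_antisymm (content_le_iff.2 fun k ↦ ?_) (sup_le ?_ (content_le_iff.2 fun k ↦ ?_))
  · rcases eq_or_ne k m with rfl | hk
    · exact Ideal.mem_sup_left (Ideal.mem_span_singleton_self _)
    · refine Ideal.mem_sup_right ?_
      simpa [AddMonoidAlgebra.coeff_erase, Finsupp.erase_ne hk] using
        coeff_mem_content (f.erase m) k
  · exact (Ideal.span_singleton_le_iff_mem _).2 (coeff_mem_content f m)
  · rw [AddMonoidAlgebra.coeff_erase, Finsupp.erase_apply]
    split_ifs
    · exact Ideal.zero_mem _
    · exact coeff_mem_content f k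

/-- Subtractivity replaces `g = h - f`, one coefficient at a time. -/
theorem content_le_of_add_eq (hS : IsSubtractiveSemiring S) {f g h : AddMonoidAlgebra S M}
    {I J : Ideal S} (hfgh : f + g = h) (hf : content S f ≤ I) (hh : content S h ≤ J) :
    content S g ≤ J + I := by
  refine content_le_iff.2 fun m ↦ hS _ (f.coeff m) _ ?_ ?_
  · refine Ideal.mem_sup_left (hh ?_)
    rw [← hfgh]
    exact coeff_mem_content (f + g) m
  · exact Ideal.mem_sup_right (hf (coeff_mem_content f m))

theorem content_mul_erase_le (hS : IsSubtractiveSemiring S) (f g : AddMonoidAlgebra S M) (m : M) :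
    content S (f * g.erase m) ≤ content S (f * g) + Ideal.span {g.coeff m} * content S f := by
  refine content_le_of_add_eq hS (f := f * AddMonoidAlgebra.single m (g.coeff m))
    (by rw [← mul_add, AddMonoidAlgebra.single_add_erase]) ?_ le_rfl
  rw [mul_comm f]
  exact (content_mul_le _ _).trans (mul_le_mul_left (content_single_le _ _) _)

end Coefficients

/-- A product of `n + 1` factors from `I + J` either uses a factor from `I` or lies in `J ^ (n +
1)`. Addition of ideals is idempotent, so multiplicities vanish. -/
theorem add_pow_succ_le {S : Type*} [CommSemiring S] (I J : Ideal S) (n : ℕ) :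
    (I + J) ^ (n + 1) ≤ I * (I + J) ^ n + J ^ (n + 1) := by
  induction n with
  | zero => simp
  | succ n ih =>
    calc (I + J) ^ (n + 2) = I * (I + J) ^ (n + 1) + J * (I + J) ^ (n + 1) := by ring
      _ ≤ I * (I + J) ^ (n + 1) + J * (I * (I + J) ^ n + J ^ (n + 1)) := by gcongr
      _ = I * (I + J) ^ (n + 1) + (I * (J * (I + J) ^ n) + J ^ (n + 2)) := by ring
      _ ≤ I * (I + J) ^ (n + 1) + (I * ((I + J) * (I + J) ^ n) + J ^ (n + 2)) := by
        have hJ : J ≤ I + J := le_sup_right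
        gcongr
      _ = (I * (I + J) ^ (n + 1) + I * (I + J) ^ (n + 1)) + J ^ (n + 2) := by ring
      _ = I * (I + J) ^ (n + 1) + J ^ (n + 2) := by
        simp only [Submodule.add_eq_sup, sup_idem]

/-- The inductive step of the Dedekind-Mertens inclusion, where `A` and `B` stand for a pair of
coefficients whose product is a coefficient of the product. -/
theorem pow_mul_le_of_split {S : Type*} [CommSemiring S] {A B I' K' J P Q : Ideal S} {n : ℕ}
    (hAB : A * B ≤ J)
    (hP : (A + I') ^ (n + 1) * K' ≤ (A + I') ^ n * P) (hPJ : P ≤ J + B * (A + I'))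
    (hQ : I' ^ (n + 2) * (B + K') ≤ I' ^ (n + 1) * Q) (hQJ : Q ≤ J + A * (B + K')) :
    (A + I') ^ (n + 2) * (B + K') ≤ (A + I') ^ (n + 1) * J := by
  set I := A + I' with hI
  have hI' : I' ≤ I := le_sup_right
  have h₁ : I ^ (n + 1) * K' ≤ I ^ n * J + B * I ^ (n + 1) :=
    calc I ^ (n + 1) * K' ≤ I ^ n * P := hP
      _ ≤ I ^ n * (J + B * I) := by gcongr
      _ = I ^ n * J + B * I ^ (n + 1) := by ring
  have h₂ : A * B * I ^ (n + 1) ≤ I ^ (n + 1) * J :=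
    calc A * B * I ^ (n + 1) ≤ J * I ^ (n + 1) := by gcongr
      _ = I ^ (n + 1) * J := by ring
  -- The extra factor `A` turns the error term of `h₁` into `A * B * I ^ (n + 1)`, which `h₂`
  -- absorbs.
  have h₃ : A * I ^ (n + 1) * (B + K') ≤ I ^ (n + 1) * J := by
    have hA : A ≤ I := le_sup_left
    calc A * I ^ (n + 1) * (B + K') = A * B * I ^ (n + 1) + A * (I ^ (n + 1) * K') := by ring
      _ ≤ A * B * I ^ (n + 1) + A * (I ^ n * J + B * I ^ (n + 1)) := by gcongr
      _ = A * I ^ n * J + (A * B * I ^ (n + 1) + A * B * I ^ (n + 1)) := by ring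
      _ ≤ I * I ^ n * J + (I ^ (n + 1) * J + I ^ (n + 1) * J) := by gcongr
      _ = I ^ (n + 1) * J + (I ^ (n + 1) * J + I ^ (n + 1) * J) := by ring
      _ ≤ I ^ (n + 1) * J := by simp only [Submodule.add_eq_sup, sup_idem, le_refl]
  have h₄ : I' ^ (n + 2) * (B + K') ≤ I ^ (n + 1) * J :=
    calc I' ^ (n + 2) * (B + K') ≤ I' ^ (n + 1) * Q := hQ
      _ ≤ I ^ (n + 1) * (J + A * (B + K')) := by gcongr
      _ = I ^ (n + 1) * J + A * I ^ (n + 1) * (B + K') := by ring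
      _ ≤ I ^ (n + 1) * J := sup_le le_rfl h₃
  calc I ^ (n + 2) * (B + K') ≤ (A * I ^ (n + 1) + I' ^ (n + 2)) * (B + K') := by
        gcongr
        exact add_pow_succ_le A I' (n + 1)
    _ = A * I ^ (n + 1) * (B + K') + I' ^ (n + 2) * (B + K') := by ring
    _ ≤ I ^ (n + 1) * J := sup_le h₃ h₄

/-- Double induction: erasing a term of `g` lowers the exponent `n`, while erasing a term of `f`
keeps it and shrinks the support of `f`. -/
theorem content_pow_mul_content_le {S M : Type*} [CommSemiring S] [AddCommMonoid M] [UniqueSums M]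
    (hS : IsSubtractiveSemiring S) (n : ℕ) (f g : AddMonoidAlgebra S M)
    (hg : g.coeff.support.card ≤ n) :
    content S f ^ (n + 1) * content S g ≤ content S f ^ n * content S (f * g) := by
  classical
  have erase_lt : ∀ {h : AddMonoidAlgebra S M} {m : M}, m ∈ h.coeff.support →
      (h.erase m).coeff.support.card < h.coeff.support.card := fun {h m} hm ↦ by
    rw [AddMonoidAlgebra.coeff_erase, Finsupp.support_erase]
    exact Finset.card_erase_lt_of_mem hm
  induction n generalizing f g with
  | zero =>
    obtain rfl : g = 0 := by simpa using hg
    simp [content_zero]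
  | succ n ih =>
    induction hk : f.coeff.support.card using Nat.strong_induction_on generalizing f with
    | _ k ihf =>
      rcases eq_or_ne f 0 with rfl | hf
      · simp [content_zero]
      rcases eq_or_ne g 0 with rfl | hg0
      · simp [content_zero]
      obtain ⟨s, hs, t, ht, hst⟩ := UniqueSums.uniqueAdd_of_nonempty
        (Finsupp.support_nonempty_iff.2 (by simpa using hf) :
          f.coeff.support.Nonempty)
        (Finsupp.support_nonempty_iff.2 (by simpa using hg0) : g.coeff.support.Nonempty)
      have hQ := ihf _ (hk ▸ erase_lt hs) (f.erase s) rfl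
      have hP := ih f (g.erase t) (by have := erase_lt ht; omega)
      have hPJ := content_mul_erase_le hS f g t
      have hQJ := content_mul_erase_le hS g f s
      rw [mul_comm g, mul_comm g] at hQJ
      rw [content_eq_span_coeff_add_content_erase f s] at hP hPJ ⊢
      rw [content_eq_span_coeff_add_content_erase g t] at hQ hQJ ⊢
      refine pow_mul_le_of_split ?_ hP hPJ hQ hQJ
      rw [Ideal.span_singleton_mul_span_singleton, Ideal.span_singleton_le_iff_mem,
        ← AddMonoidAlgebra.coeff_mul_add_of_uniqueAdd hst]
      exact coeff_mem_content _ _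

/-- The Dedekind-Mertens content formula over a subtractive semiring. -/
theorem dedekindMertens_of_isSubtractiveSemiring {S M : Type*} [CommSemiring S] [AddCommMonoid M]
    [UniqueSums M] (hS : IsSubtractiveSemiring S) : DedekindMertens S (AddMonoidAlgebra S M) := by
  refine fun f g ↦ ⟨g.coeff.support.card, le_antisymm
    (content_pow_mul_content_le hS _ f g le_rfl) ?_⟩
  rw [pow_succ, mul_assoc]
  exact mul_le_mul_right (content_mul_le f g) _

/-- The Dedekind-Mertens content formula for `1 + X` and `a + b X + a X ^ 2` forces `b` to lie in
every ideal that contains `a + b` and `a`. -/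
theorem isSubtractiveSemiring_of_dedekindMertens {S M : Type*} [CommSemiring S]
    [AddCancelCommMonoid M] [Nontrivial M] (h : DedekindMertens S (AddMonoidAlgebra S M)) :
    IsSubtractiveSemiring S := by
  classical
  intro I a b hab ha
  obtain ⟨u, hu⟩ := exists_ne (0 : M)
  let f : AddMonoidAlgebra S M := AddMonoidAlgebra.single 0 1 + AddMonoidAlgebra.single u 1
  let g : AddMonoidAlgebra S M := AddMonoidAlgebra.single 0 a + AddMonoidAlgebra.single u b +
    AddMonoidAlgebra.single (u + u) a
  have hf : content S f = ⊤ := content_eq_top_of_coeff_eq_one (m := 0) (by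
    simp [f, hu])
  obtain ⟨m, hm⟩ := h f g
  simp only [hf, Ideal.top_pow, Ideal.top_mul] at hm
  have hfg : f * g = AddMonoidAlgebra.single 0 a + AddMonoidAlgebra.single u (a + b) +
      AddMonoidAlgebra.single (u + u) (a + b) + AddMonoidAlgebra.single (u + (u + u)) a := by
    simp only [f, g, add_mul, mul_add, AddMonoidAlgebra.single_mul_single, zero_add, add_zero,
      one_mul, AddMonoidAlgebra.single_add]
    abel
  have hle : content S (f * g) ≤ I := by
    have hsingle : ∀ (k : M) {s : S}, s ∈ I → ∀ i,
        (AddMonoidAlgebra.single k s).coeff i ∈ I := fun k s hs ↦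
      content_le_iff.1 ((content_single_le k s).trans ((Ideal.span_singleton_le_iff_mem I).2 hs))
    rw [hfg]
    exact content_le_iff.2 fun i ↦ I.add_mem (I.add_mem (I.add_mem (hsingle _ ha i)
      (hsingle _ hab i)) (hsingle _ hab i)) (hsingle _ ha i)
  -- Cancellation gives `u + u ≠ u`, so `b` stands alone at `u`; a coincidence `u + u = 0` would be
  -- harmless.
  have hb : g.coeff u = b := by
    simp [g, hu]
  exact hle (hm ▸ hb ▸ coeff_mem_content g u)

end SemiringContent

theorem theorem3p10 (S : Type*) [CommSemiring S] [Nontrivial S]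
    (M : Type*) [AddCancelCommMonoid M] [IsAddTorsionFree M] [Nontrivial M] :
    (SemiringContent.IsContentSemialgebra S (AddMonoidAlgebra S M) ↔
      SemiringContent.IsSubtractiveSemiring S) ∧
    (SemiringContent.DedekindMertens S (AddMonoidAlgebra S M) ↔
      SemiringContent.IsSubtractiveSemiring S) := by
  have : UniqueSums M := AddCancelCommMonoid.uniqueSums_of_isAddTorsionFree M
  have hDM : SemiringContent.DedekindMertens S (AddMonoidAlgebra S M) ↔
      SemiringContent.IsSubtractiveSemiring S :=
    ⟨SemiringContent.isSubtractiveSemiring_of_dedekindMertens,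
      SemiringContent.dedekindMertens_of_isSubtractiveSemiring⟩
  refine ⟨⟨fun h ↦ hDM.1 h.dedekindMertens, fun h ↦ ⟨fun f ↦ ?_, SemiringContent.content_smul, ?_,
    hDM.2 h⟩⟩, hDM⟩
  · exact (SemiringContent.mem_map_algebraMap_iff _ f).2 (SemiringContent.coeff_mem_content f)
  · refine top_le_iff.1 (le_iSup_of_le (AddMonoidAlgebra.single 0 1) ?_)
    exact (SemiringContent.content_eq_top_of_coeff_eq_one (m := 0) (by simp)).ge
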